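/- Call an affine subspace of $\mathbb{C}^d$ of dimension $k$ a $k$-flat. For a finite set $V\subset\mathbb{C}^d$ and an integer $r$, let $\mathcal{L}_r(V)$ denote the set of $r$-rich lines of $V$, i.e. the (complex affine) lines in $\mathbb{C}^d$ that contain at least $r$ points of $V$. (i) There are absolute constants $c,c'>0$ such that the following holds for every $d\ge 1$ with $C_d=d^{cd}$ and $C_d'=d^{c'd}$. Let $V\subset\mathbb{C}^d$ be a set of $n$ points, let $r\ge 2$ be an integer, and suppose that for some real $\alpha\ge 1$ $$|\mathcal{L}_r(V)|\ \ge\ C_d\cdot\alpha\cdot\frac{n^2}{r^d}.$$ Then there is a subset $\tilde V\subset V$ of size at least $C_d'\cdot\alpha\cdot\dfrac{n}{r^{d-2}}$ that is contained in a $(d-1)$-flat. (ii) Equivalently (up to the values of the constants): for every $d\ge 1$ there is a constant $C>0$, depending only on $d$, such that for every set $V\subset\mathbb{C}^d$ of $n$ points and every integer $r\ge 2$, $$|\mathcal{L}_r(V)|\ \le\ C\left(\frac{n^2}{r^d}+\frac{n\,s_{d-1}}{r^2}\right),$$ where $s_{d-1}$ is the largest number of points of $V$ contained in a hyperplane, i.e.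 in a $(d-1)$-flat. -/

import Mathlib

/-- `H` is a `k`-flat of `ℂ^d`: a (nonempty) affine subspace of dimension exactly `k`. -/
def IsFlat {d : ℕ} (k : ℕ) (H : AffineSubspace ℂ (Fin d → ℂ)) : Prop :=
  (H : Set (Fin d → ℂ)).Nonempty ∧ Module.finrank ℂ H.direction = k

/-- The number of points of the finite set `V` that lie on the affine subspace `H`. -/
noncomputable def pointsOn {d : ℕ} (V : Finset (Fin d → ℂ))
    (H : AffineSubspace ℂ (Fin d → ℂ)) : ℕ :=
  ((V : Set (Fin d → ℂ)) ∩ (H : Set (Fin d → ℂ))).ncard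

/-- The set of `r`-rich lines of `V`: the lines that contain at least `r` points of `V`. -/
def richLines {d : ℕ} (r : ℕ) (V : Finset (Fin d → ℂ)) :
    Set (AffineSubspace ℂ (Fin d → ℂ)) :=
  {L | IsFlat 1 L ∧ r ≤ pointsOn V L}

/-- The largest number of points of `V` contained in a `k`-flat. -/
noncomputable def maxOnFlat {d : ℕ} (k : ℕ) (V : Finset (Fin d → ℂ)) : ℕ :=
  sSup {m : ℕ | ∃ H : AffineSubspace ℂ (Fin d → ℂ), IsFlat k H ∧ pointsOn V H = m}

/-- For `r ≥ 2` there are finitely many `r`-rich lines, so `Set.ncard` really counts them. -/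
theorem richLines_finite {d r : ℕ} (hr : 2 ≤ r) (V : Finset (Fin d → ℂ)) :
    (richLines r V).Finite := by
  refine Set.Finite.of_injOn
    (f := fun L : AffineSubspace ℂ (Fin d → ℂ) => (V : Set (Fin d → ℂ)) ∩ (L : Set (Fin d → ℂ)))
    (t := 𝒫 (V : Set (Fin d → ℂ))) (fun L _ => Set.inter_subset_left) ?_
    V.finite_toSet.finite_subsets
  rintro L₁ ⟨⟨_, h₁⟩, hc⟩ L₂ ⟨⟨_, h₂⟩, _⟩ he
  have h2 : 1 < ((V : Set (Fin d → ℂ)) ∩ (L₁ : Set (Fin d → ℂ))).ncard :=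
    lt_of_lt_of_le hr hc
  obtain ⟨p, hp, q, hq, hpq⟩ := (Set.one_lt_ncard (V.finite_toSet.inter_of_left _)).1 h2
  have he' : (V : Set (Fin d → ℂ)) ∩ (L₁ : Set (Fin d → ℂ))
      = (V : Set (Fin d → ℂ)) ∩ (L₂ : Set (Fin d → ℂ)) := he
  have key : ∀ L : AffineSubspace ℂ (Fin d → ℂ), Module.finrank ℂ L.direction = 1 →
      p ∈ L → q ∈ L → L = line[ℂ, p, q] := by
    intro L hL hpL hqL
    have hle : line[ℂ, p, q] ≤ L := affineSpan_pair_le_of_mem_of_mem hpL hqL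
    have hne : ((line[ℂ, p, q] : AffineSubspace ℂ (Fin d → ℂ)) : Set (Fin d → ℂ)).Nonempty :=
      ⟨p, left_mem_affineSpan_pair ℂ p q⟩
    have hd : Module.finrank ℂ (line[ℂ, p, q] : AffineSubspace ℂ (Fin d → ℂ)).direction = 1 := by
      rw [direction_affineSpan, vectorSpan_pair_rev]
      exact finrank_span_singleton (by simpa [sub_eq_zero] using hpq.symm)
    refine (AffineSubspace.eq_of_direction_eq_of_nonempty_of_le ?_ hne hle).symm
    exact Submodule.eq_of_le_of_finrank_eq (AffineSubspace.direction_le hle) (hd.trans hL.symm)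
  have hp2 := he' ▸ hp
  have hq2 := he' ▸ hq
  rw [key L₁ h₁ hp.2 hq.2, key L₂ h₂ hp2.2 hq2.2]

/-- For `k ≤ d` the maximum in `maxOnFlat` is attained, so it is not a junk value. -/
theorem maxOnFlat_isGreatest {d k : ℕ} (hk : k ≤ d) (V : Finset (Fin d → ℂ)) :
    IsGreatest {m : ℕ | ∃ H : AffineSubspace ℂ (Fin d → ℂ), IsFlat k H ∧ pointsOn V H = m}
      (maxOnFlat k V) := by
  have hb : BddAbove {m : ℕ | ∃ H : AffineSubspace ℂ (Fin d → ℂ),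
      IsFlat k H ∧ pointsOn V H = m} := by
    refine ⟨V.card, ?_⟩
    rintro m ⟨H, -, rfl⟩
    rw [← Set.ncard_coe_finset V]
    exact Set.ncard_le_ncard Set.inter_subset_left V.finite_toSet
  refine ⟨Nat.sSup_mem ?_ hb, fun m hm => le_csSup hb hm⟩
  have hli : LinearIndependent ℂ (fun i : Fin k => Pi.basisFun ℂ (Fin d) (Fin.castLE hk i)) :=
    (Pi.basisFun ℂ (Fin d)).linearIndependent.comp _ (Fin.castLE_injective hk)
  exact ⟨_, AffineSubspace.mk' 0 (Submodule.span ℂ (Set.range fun i : Fin k =>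
    Pi.basisFun ℂ (Fin d) (Fin.castLE hk i))), ⟨AffineSubspace.mk'_nonempty 0 _, by
      rw [AffineSubspace.direction_mk', finrank_span_eq_card hli, Fintype.card_fin]⟩, rfl⟩

/-! The proof is the polynomial method combined with a rank bound for design matrices. Let there be
`N` rich lines on `n` points. `exists_regular_subsystem` passes to points `V'` and lines such that
every point has degree at least `k = N r / (4 n)` and every line keeps at least `r / 2` points of
`V'`.

On a line with `s` chosen points, a top divided difference annihilates all polynomials of degree at
most `s - 2`, with no zero coefficient (`IsFlat.exists_relation`). These relations are the rows of a
matrix whose kernel contains the evaluation vectors of all polynomials of low degree. Distinct lines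
share at most one point, so `sq_mul_finrank_ker_le` bounds the kernel dimension by `N r² / k² = 16
n² / N`. The proof of that bound scales the matrix to prescribed row and column norms and compares
the off-diagonal part of its Gram matrix with the diagonal. If `N` is a large multiple of `n² /
r^d`, the polynomials outnumber this dimension, and a nonzero one vanishes on `V'`
(`exists_vanishing_polynomial`).

Differentiating if necessary gives such a polynomial with nonzero gradient at some `v` in `V'`. It
vanishes identically on each chosen line through `v`, so all of these lie in the hyperplane
orthogonal to the gradient. Together they carry at least `k (r - 1)` points besides `v`, which gives
the dichotomy `ncard_richLines_le_or` and hence both parts. -/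

/-! ### Matrix scaling by convex minimisation -/

/-- A function `a e^z - z` with `a > 0` grows at least like `|z|`. -/
theorem exists_abs_sub_le_mul_exp_sub {a : ℝ} (ha : 0 < a) :
    ∃ C : ℝ, ∀ z : ℝ, |z| - C ≤ a * Real.exp z - z := by
  -- The tangent bound for `exp` at `z + log (a / 2)` gives `a e^z ≥ 2 z - C` for this constant `C`,
  -- which settles `z ≥ 0`; for `z < 0` the term `-z` suffices.
  refine ⟨2 * |Real.log (a / 2)|, fun z => ?_⟩
  have h1 := Real.add_one_le_exp (z + Real.log (a / 2))
  rw [Real.exp_add, Real.exp_log (by positivity)] at h1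
  have h2 := neg_abs_le (Real.log (a / 2))
  have h3 := Real.exp_pos z
  have h4 := abs_nonneg (Real.log (a / 2))
  rcases abs_cases z with ⟨h, _⟩ | ⟨h, _⟩ <;> rw [h]
  · nlinarith
  · nlinarith [mul_pos ha h3]

/-- The first-order condition for the minimum of `∑ (aᵢ e^{zᵢ} - zᵢ)` over a linear subspace,
which is attained since the function is coercive. -/
theorem exists_mem_sum_mul_exp_sub_one_mul_eq_zero {I : Type*} [Fintype I] (a : I → ℝ)
    (ha : ∀ i, 0 < a i) (U : Submodule ℝ (I → ℝ)) :
    ∃ z ∈ U, ∀ u ∈ U, ∑ i, (a i * Real.exp (z i) - 1) * u i = 0 := by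
  choose C hC using fun i => exists_abs_sub_le_mul_exp_sub (ha i)
  let G : (I → ℝ) → ℝ := fun z => ∑ i, (a i * Real.exp (z i) - z i)
  have hG : Continuous G := by fun_prop
  have hbound : ∀ z, ‖z‖ - ∑ i, C i ≤ G z := fun z => by
    have h1 : ‖z‖ ≤ ∑ i, |z i| :=
      (pi_norm_le_iff_of_nonneg (Finset.sum_nonneg fun i _ => abs_nonneg _)).2 fun i =>
        Finset.single_le_sum (f := fun i => |z i|) (fun i _ => abs_nonneg _) (Finset.mem_univ i)
    have h2 : ∑ i, (|z i| - C i) ≤ G z := Finset.sum_le_sum fun i _ => hC i (z i)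
    rw [Finset.sum_sub_distrib] at h2
    linarith
  have hcoe : Filter.Tendsto G (Filter.cocompact (I → ℝ)) Filter.atTop :=
    Filter.tendsto_atTop_mono hbound
      (Filter.tendsto_atTop_add_const_right _ _ (tendsto_norm_cocompact_atTop))
  obtain ⟨z, hzU, hz⟩ := hG.continuousOn.exists_isMinOn' (s := (U : Set (I → ℝ)))
    U.closed_of_finiteDimensional U.zero_mem
    ((hcoe.eventually_ge_atTop (G 0)).filter_mono inf_le_left)
  refine ⟨z, hzU, fun u hu => ?_⟩
  have hder : HasDerivAt (fun s : ℝ => G (z + s • u))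
      (∑ i, (a i * Real.exp (z i) - 1) * u i) 0 := by
    refine HasDerivAt.fun_sum fun i _ => ?_
    have hlin : HasDerivAt (fun s : ℝ => (z + s • u) i) (u i) 0 := by
      simpa using ((hasDerivAt_id (0 : ℝ)).mul_const (u i)).const_add (z i)
    have := (hlin.exp.const_mul (a i)).fun_sub hlin
    rw [zero_smul, add_zero] at this
    convert this using 1
    ring
  have hmin : IsLocalMin (fun s : ℝ => G (z + s • u)) 0 :=
    Filter.Eventually.of_forall fun s => by
      simpa using hz (U.add_mem hzU (U.smul_mem s hu))
  exact hmin.hasDerivAt_eq_zero hder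

/-- A matrix can be rescaled, by positive factors on its rows and columns, so that the squared
norms of the entries of every row and column sum to the size of its support. -/
theorem exists_scaling {L V : Type*} [Fintype L] [Fintype V] (A : L → V → ℂ) :
    ∃ (x : L → ℝ) (y : V → ℝ), (∀ l, 0 < x l) ∧ (∀ v, 0 < y v) ∧
      (∀ l, ∑ v, ‖(x l * y v : ℂ) * A l v‖ ^ 2 = (Finset.univ.filter fun v => A l v ≠ 0).card) ∧
      (∀ v, ∑ l, ‖(x l * y v : ℂ) * A l v‖ ^ 2 =
        (Finset.univ.filter fun l => A l v ≠ 0).card) := by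
  classical
  let I := {p : L × V // A p.1 p.2 ≠ 0}
  -- The range of `T` consists of the logarithmic scalings of the squared entries on the support;
  -- minimising over it makes the stationarity condition a statement about row and column sums.
  let T : ((L → ℝ) × (V → ℝ)) →ₗ[ℝ] (I → ℝ) :=
    { toFun := fun w i => w.1 i.1.1 + w.2 i.1.2
      map_add' := fun w w' => by ext i; simp; ring
      map_smul' := fun c w => by ext i; simp; ring }
  obtain ⟨z, ⟨w, rfl⟩, hw⟩ := exists_mem_sum_mul_exp_sub_one_mul_eq_zero
    (fun i : I => ‖A i.1.1 i.1.2‖ ^ 2) (fun i => by have := norm_pos_iff.2 i.2; positivity)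
    (LinearMap.range T)
  let B : L → V → ℝ := fun l v => ‖((Real.exp (w.1 l / 2) : ℝ) * (Real.exp (w.2 v / 2) : ℝ) : ℂ)
    * A l v‖ ^ 2
  have hB : ∀ l v, B l v = ‖A l v‖ ^ 2 * Real.exp (w.1 l + w.2 v) := fun l v => by
    simp only [B, norm_mul, Complex.norm_real, Real.norm_eq_abs, Real.abs_exp]
    rw [mul_pow, mul_pow, ← Real.exp_nat_mul, ← Real.exp_nat_mul, ← Real.exp_add, mul_comm]
    congr 2
    push_cast
    ring
  have key : ∀ w' : (L → ℝ) × (V → ℝ),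
      ∑ l, ∑ v, (B l v - if A l v ≠ 0 then 1 else 0) * (w'.1 l + w'.2 v) = 0 := by
    intro w'
    refine Eq.trans ?_ (hw _ ⟨w', rfl⟩)
    rw [← Fintype.sum_prod_type'
      (f := fun l v => (B l v - if A l v ≠ 0 then 1 else 0) * (w'.1 l + w'.2 v)),
      ← Finset.sum_filter_of_ne (p := fun p : L × V => A p.1 p.2 ≠ 0),
      Finset.sum_subtype (p := fun p : L × V => A p.1 p.2 ≠ 0) _ (by simp)]
    · refine Finset.sum_congr rfl fun i _ => ?_
      rw [hB, if_pos i.2]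
      rfl
    · intro p _ hp h
      simp [hB, h] at hp
  refine ⟨fun l => Real.exp (w.1 l / 2), fun v => Real.exp (w.2 v / 2),
    fun l => Real.exp_pos _, fun v => Real.exp_pos _, fun l₀ => ?_, fun v₀ => ?_⟩
  -- Testing stationarity against the indicator of one row isolates that row sum; the other case
  -- does the same for a column.
  · have := key (Pi.single l₀ 1, 0)
    simp only [Pi.zero_apply, add_zero, ← Finset.sum_mul] at this
    rw [Finset.sum_eq_single l₀ (by intro b _ hb; simp [hb]) (by simp)] at this
    simpa only [Pi.single_eq_same, mul_one, Finset.sum_sub_distrib, Finset.sum_boole, sub_eq_zero]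
      using this
  · have := key (0, Pi.single v₀ 1)
    rw [Finset.sum_comm] at this
    simp only [Pi.zero_apply, zero_add, ← Finset.sum_mul] at this
    rw [Finset.sum_eq_single v₀ (by intro b _ hb; simp [hb]) (by simp)] at this
    simpa only [Pi.single_eq_same, mul_one, Finset.sum_sub_distrib, Finset.sum_boole, sub_eq_zero]
      using this

/-! ### Kernels of design matrices -/

/-- If `O u = D u` for all `u` in a subspace, where `D` is a diagonal matrix with entries of norm at
least `k`, then the dimension of the subspace is at most `‖O‖² / k²`, in the Frobenius norm. -/
theorem sq_mul_finrank_le_of_eq_diag {V : Type*} [Fintype V] [DecidableEq V]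
    (O : V → V → ℂ) (D : V → ℂ) {k : ℝ} (hk : 0 ≤ k) (hD : ∀ v, k ≤ ‖D v‖)
    (K : Submodule ℂ (EuclideanSpace ℂ V))
    (hK : ∀ u ∈ K, ∀ v, ∑ w, O v w * u w = D v * u v) :
    k ^ 2 * Module.finrank ℂ K ≤ ∑ v, ∑ w, ‖O v w‖ ^ 2 := by
  let b := stdOrthonormalBasis ℂ K
  have hb : Orthonormal ℂ fun i => (b i : EuclideanSpace ℂ V) :=
    b.orthonormal.comp_linearIsometry K.subtypeₗᵢ
  -- Bessel's inequality for the conjugated row `v` of `O`, whose inner products with the basis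
  -- vectors are the entries of `O b i = D b i`.
  have hrow : ∀ v, ∑ i, ‖D v * (b i : EuclideanSpace ℂ V) v‖ ^ 2 ≤ ∑ w, ‖O v w‖ ^ 2 := by
    intro v
    have := hb.sum_inner_products_le (s := Finset.univ)
      (WithLp.toLp 2 fun w => starRingEnd ℂ (O v w))
    rw [EuclideanSpace.norm_sq_eq] at this
    simp only [RCLike.norm_conj] at this
    refine le_trans (le_of_eq (Finset.sum_congr rfl fun i _ => ?_)) this
    rw [← hK _ (b i).2 v, ← norm_inner_symm, PiLp.inner_apply]
    simp [mul_comm]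
  calc k ^ 2 * Module.finrank ℂ K
      = ∑ i, k ^ 2 * ‖(b i : EuclideanSpace ℂ V)‖ ^ 2 := by
        simp [hb.1, mul_comm]
    _ ≤ ∑ i, ∑ v, ‖D v * (b i : EuclideanSpace ℂ V) v‖ ^ 2 := by
        refine Finset.sum_le_sum fun i _ => ?_
        rw [EuclideanSpace.norm_sq_eq, Finset.mul_sum]
        refine Finset.sum_le_sum fun v _ => ?_
        rw [norm_mul, mul_pow]
        gcongr
        exact hD v
    _ = ∑ v, ∑ i, ‖D v * (b i : EuclideanSpace ℂ V) v‖ ^ 2 := Finset.sum_comm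
    _ ≤ _ := Finset.sum_le_sum fun v _ => hrow v

/-- The kernel of a design matrix is small: if every row has at most `r` nonzero entries, every
column at least `k`, and any two columns share at most one row of their supports, then the kernel
has dimension at most `|L| r² / k²`. -/
theorem sq_mul_finrank_ker_le {L V : Type*} [Fintype L] [Fintype V] (A : Matrix L V ℂ)
    {k : ℝ} {r : ℕ} (hk : 0 ≤ k)
    (hrow : ∀ l, (Finset.univ.filter fun v => A l v ≠ 0).card ≤ r)
    (hcol : ∀ v, k ≤ (Finset.univ.filter fun l => A l v ≠ 0).card)
    (hpair : ∀ u v, u ≠ v → ∀ l l', A l u ≠ 0 → A l v ≠ 0 → A l' u ≠ 0 → A l' v ≠ 0 → l = l') :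
    k ^ 2 * Module.finrank ℂ (LinearMap.ker A.mulVecLin) ≤ Fintype.card L * (r : ℝ) ^ 2 := by
  classical
  obtain ⟨x, y, hx, hy, hr, hc⟩ := exists_scaling A
  let B : L → V → ℂ := fun l v => (x l * y v : ℂ) * A l v
  have hyC : ∀ v, (y v : ℂ) ≠ 0 := fun v => by exact_mod_cast (hy v).ne'
  have hB : ∀ l v, B l v ≠ 0 → A l v ≠ 0 := fun l v => right_ne_zero_of_mul
  -- `O` is the off-diagonal part of the Gram matrix of `B`, and `D` is minus its diagonal, so `B u
  -- = 0` implies `O u = D u`.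
  let O : V → V → ℂ := fun v w => if v = w then 0 else ∑ l, starRingEnd ℂ (B l v) * B l w
  let D : V → ℂ := fun v => -∑ l, (‖B l v‖ ^ 2 : ℂ)
  have hD : ∀ v, k ≤ ‖D v‖ := fun v => by
    have : D v = ((-(Finset.univ.filter fun l => A l v ≠ 0).card : ℝ) : ℂ) := by
      rw [← hc v]; simp [D, B]
    rw [this, Complex.norm_real, norm_neg, Real.norm_natCast]
    exact hcol v
  -- Row scaling leaves the kernel unchanged; column scaling is undone by dividing coordinates by
  -- `y`.
  let e : (V → ℂ) ≃ₗ[ℂ] EuclideanSpace ℂ V :=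
    (LinearEquiv.piCongrRight fun v => LinearEquiv.smulOfNeZero ℂ ℂ _ (inv_ne_zero (hyC v))) ≪≫ₗ
      (WithLp.linearEquiv 2 ℂ (V → ℂ)).symm
  have he : ∀ u v, e u v = (y v : ℂ)⁻¹ * u v := fun u v => rfl
  have hker : ∀ u ∈ (LinearMap.ker A.mulVecLin).map e.toLinearMap,
      ∀ v, ∑ w, O v w * u w = D v * u v := by
    rintro _ ⟨u, hu, rfl⟩ v
    have hu' : ∀ l, ∑ w, B l w * e u w = 0 := fun l => by
      have h1 : ∑ w, A l w * u w = 0 := congrFun (LinearMap.mem_ker.1 hu) l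
      calc ∑ w, B l w * e u w = ∑ w, x l * (A l w * u w) :=
            Finset.sum_congr rfl fun w _ => by rw [he]; have := hyC w; simp only [B]; field_simp
        _ = 0 := by rw [← Finset.mul_sum, h1, mul_zero]
    have h2 : ∑ w, (∑ l, starRingEnd ℂ (B l v) * B l w) * e u w = 0 := by
      simp only [Finset.sum_mul]
      rw [Finset.sum_comm]
      simp only [mul_assoc, ← Finset.mul_sum, hu', mul_zero, Finset.sum_const_zero]
    rw [← Finset.add_sum_erase _ _ (Finset.mem_univ v)] at h2 ⊢
    have h3 : ∑ w ∈ Finset.univ.erase v, O v w * e u w = ∑ w ∈ Finset.univ.erase v,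
        (∑ l, starRingEnd ℂ (B l v) * B l w) * e u w :=
      Finset.sum_congr rfl fun w hw => by
        simp only [O, if_neg (Finset.ne_of_mem_erase hw).symm]
    simp only [LinearEquiv.coe_coe]
    rw [h3]
    simp only [O, D, if_true, Complex.conj_mul'] at h2 ⊢
    linear_combination h2
  -- By `hpair` at most one row contributes to an off-diagonal entry, so no cross terms appear when
  -- it is squared.
  have hO : ∀ v w, ‖O v w‖ ^ 2 ≤ ∑ l, ‖B l v‖ ^ 2 * ‖B l w‖ ^ 2 := by
    intro v w
    by_cases hvw : v = w
    · simp only [O, if_pos hvw]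
      simpa using Finset.sum_nonneg fun l _ => by positivity
    simp only [O, if_neg hvw]
    by_cases hex : ∃ l, B l v ≠ 0 ∧ B l w ≠ 0
    · obtain ⟨l, h1, h2⟩ := hex
      have huniq : ∀ l', l' ≠ l → starRingEnd ℂ (B l' v) * B l' w = 0 := by
        intro l' hl'
        by_contra h
        refine hl' (hpair v w hvw l' l (hB _ _ ?_) (hB _ _ (right_ne_zero_of_mul h))
          (hB _ _ h1) (hB _ _ h2))
        simpa using left_ne_zero_of_mul h
      rw [Finset.sum_eq_single l (fun l' _ => huniq l') (by simp), norm_mul, RCLike.norm_conj,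
        mul_pow]
      exact Finset.single_le_sum (f := fun l => ‖B l v‖ ^ 2 * ‖B l w‖ ^ 2)
        (fun l _ => by positivity) (Finset.mem_univ l)
    · push Not at hex
      rw [Finset.sum_eq_zero]
      · simpa using Finset.sum_nonneg fun l _ => by positivity
      · intro l _
        by_cases h : B l v = 0
        · simp [h]
        · simp [hex l h]
  have hmain := sq_mul_finrank_le_of_eq_diag O D hk hD _ hker
  rw [LinearEquiv.finrank_map_eq] at hmain
  refine hmain.trans ?_
  calc ∑ v, ∑ w, ‖O v w‖ ^ 2 ≤ ∑ v, ∑ w, ∑ l, ‖B l v‖ ^ 2 * ‖B l w‖ ^ 2 :=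
        Finset.sum_le_sum fun v _ => Finset.sum_le_sum fun w _ => hO v w
    _ = ∑ l, (∑ v, ‖B l v‖ ^ 2) * ∑ w, ‖B l w‖ ^ 2 := by
        simp_rw [Finset.sum_mul_sum]
        rw [Finset.sum_congr rfl fun v _ => Finset.sum_comm, Finset.sum_comm]
    _ ≤ ∑ l : L, (r : ℝ) ^ 2 := by
        refine Finset.sum_le_sum fun l _ => ?_
        simp only [B]
        rw [hr l, ← sq]
        gcongr
        exact hrow l
    _ = _ := by simp

/-! ### Pruning to a regular incidence system -/

/-- Every system of `r`-element subsets of `V` contains a nonempty subsystem in which all degrees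
are at least a quarter of the average degree and all sets keep at least half of their points. -/
theorem exists_regular_subsystem {α β : Type*} [DecidableEq α] (V : Finset α)
    (L : Finset β) (S : β → Finset α) {r : ℕ} (hr : 0 < r) (hV : V.Nonempty) (hL : L.Nonempty)
    (hS : ∀ l ∈ L, S l ⊆ V ∧ (S l).card = r) :
    ∃ V' ⊆ V, ∃ L' ⊆ L, V'.Nonempty ∧
      (∀ v ∈ V', L.card * r ≤ 4 * V.card * (L'.filter fun l => v ∈ S l).card) ∧
      ∀ l ∈ L', r ≤ 2 * (S l ∩ V').card := by
  classical
  -- A maximiser of incidences minus a price per point and per line: deleting a point or line cannot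
  -- increase `ψ`, so each one kept pays its price. The weights make `ψ (V, L) > 0`, which keeps the
  -- maximiser nonempty.
  let ψ : Finset α × Finset β → ℤ := fun p => 4 * V.card * ∑ l ∈ p.2, ((S l ∩ p.1).card : ℤ)
    - L.card * r * p.1.card - 2 * V.card * r * p.2.card
  obtain ⟨⟨V', L'⟩, hmem, hmax⟩ := Finset.exists_max_image (V.powerset ×ˢ L.powerset) ψ
    ⟨(V, L), by simp⟩
  simp only [Finset.mem_product, Finset.mem_powerset] at hmem hmax
  have hVpos : 0 < V.card := hV.card_pos
  have hLpos : 0 < L.card := hL.card_pos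
  have hVL : ψ (V, L) = V.card * L.card * r := by
    have : ∑ l ∈ L, ((S l ∩ V).card : ℤ) = ∑ l ∈ L, (r : ℤ) :=
      Finset.sum_congr rfl fun l hl => by
        rw [Finset.inter_eq_left.2 (hS l hl).1, (hS l hl).2]
    simp only [ψ, this, Finset.sum_const, nsmul_eq_mul]
    ring
  have hpos : 0 < ψ (V', L') := by
    refine lt_of_lt_of_le ?_ (hmax (V, L) ⟨subset_rfl, subset_rfl⟩)
    rw [hVL]
    positivity
  refine ⟨V', hmem.1, L', hmem.2, ?_, fun v hv => ?_, fun l hl => ?_⟩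
  · by_contra h
    rw [Finset.not_nonempty_iff_eq_empty] at h
    subst h
    have : (0 : ℤ) ≤ 2 * V.card * r * L'.card := by positivity
    simp only [ψ, Finset.inter_empty, Finset.card_empty, Nat.cast_zero, Finset.sum_const_zero,
      mul_zero, sub_zero, zero_sub] at hpos
    linarith
  · have h := hmax (V'.erase v, L') ⟨(Finset.erase_subset _ _).trans hmem.1, hmem.2⟩
    have hsum : ∑ l ∈ L', ((S l ∩ V').card : ℤ) = ∑ l ∈ L', ((S l ∩ V'.erase v).card : ℤ) +
        (L'.filter fun l => v ∈ S l).card := by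
      rw [Finset.card_filter]
      push_cast
      rw [← Finset.sum_add_distrib]
      refine Finset.sum_congr rfl fun l _ => ?_
      rw [Finset.inter_erase]
      split_ifs with hvl
      · rw [← Finset.card_erase_add_one (Finset.mem_inter.2 ⟨hvl, hv⟩)]
        push_cast
        rfl
      · rw [Finset.erase_eq_of_notMem (by simp [hvl]), add_zero]
    have hc : ((V'.erase v).card : ℤ) + 1 = V'.card := by
      exact_mod_cast Finset.card_erase_add_one hv
    simp only [ψ, hsum, ← hc] at h
    zify
    linarith
  · have h := hmax (V', L'.erase l) ⟨hmem.1, (Finset.erase_subset _ _).trans hmem.2⟩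
    have hc : ((L'.erase l).card : ℤ) + 1 = L'.card := by
      exact_mod_cast Finset.card_erase_add_one hl
    simp only [ψ, ← Finset.add_sum_erase _ _ hl, ← hc] at h
    have h2 : (0 : ℤ) ≤ 2 * V.card * (2 * (S l ∩ V').card - r) := by linarith
    have h3 := nonneg_of_mul_nonneg_right h2 (by positivity)
    zify
    linarith

/-! ### Polynomials, gradients and restriction to lines -/

open MvPolynomial in
/-- A nonzero polynomial of minimal degree among those vanishing on a nonempty set has a partial
derivative that does not vanish identically on the set. -/
theorem exists_polynomial_pderiv_ne_zero {d δ : ℕ} {V : Set (Fin d → ℂ)} (hV : V.Nonempty)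
    {f : MvPolynomial (Fin d) ℂ} (hf : f ≠ 0) (hdeg : f.totalDegree ≤ δ)
    (hfV : ∀ v ∈ V, eval v f = 0) :
    ∃ g : MvPolynomial (Fin d) ℂ, g.totalDegree ≤ δ ∧ (∀ v ∈ V, eval v g = 0) ∧
      ∃ v ∈ V, ∃ i, eval v (pderiv i g) ≠ 0 := by
  induction δ using Nat.strong_induction_on generalizing f with
  | _ δ ih =>
    by_contra! hcon
    -- By `hcon` every partial derivative of `f` also vanishes on `V`; a nonzero one has smaller
    -- degree, so the induction hypothesis contradicts `hcon`.
    have hder : ∀ i, pderiv i f ≠ 0 → False := fun i hi => by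
      have hlt : (pderiv i f).totalDegree < f.totalDegree := by
        obtain ⟨m, hm, hmd⟩ := Finset.exists_mem_eq_sup (pderiv i f).support
          (by simpa [MvPolynomial.support_nonempty] using hi) fun s => s.sum fun _ e => e
        have h1 := MvPolynomial.mem_support_iff.1 hm
        rw [coeff_pderiv] at h1
        have h2 := le_totalDegree (MvPolynomial.mem_support_iff.2 (left_ne_zero_of_mul h1))
        rw [Finsupp.sum_add_index' (by simp) (by simp)] at h2
        simp only [Finsupp.sum_single_index] at h2
        have h3 : (pderiv i f).totalDegree = m.sum fun _ e => e := hmd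
        omega
      obtain ⟨g, hg, hgV, v, hv, j, hj⟩ := ih _ (hlt.trans_le hdeg) hi le_rfl
        fun v hv => hcon f hdeg hfV v hv i
      exact hj (hcon g (hg.trans (hlt.le.trans hdeg)) hgV v hv j)
    have hC : f = C (coeff 0 f) := by
      ext m
      rw [coeff_C]
      split_ifs with h
      · rw [h]
      · obtain ⟨i, hi⟩ : ∃ i, m i ≠ 0 := by
          by_contra! h'
          exact h (Finsupp.ext fun i => (h' i).symm)
        have h0 : pderiv i f = 0 := by by_contra h'; exact hder i h'
        have h1 := coeff_pderiv (i := i) f (m - Finsupp.single i 1)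
        rw [h0, coeff_zero, tsub_add_cancel_of_le (Finsupp.single_le_iff.2
          (Nat.one_le_iff_ne_zero.2 hi))] at h1
        refine (mul_eq_zero.1 h1.symm).resolve_right ?_
        exact Nat.cast_add_one_ne_zero _
    obtain ⟨v, hv⟩ := hV
    have h0 := hfV v hv
    rw [hC, eval_C] at h0
    rw [h0, C_0] at hC
    exact hf hC

/-- The restriction of a polynomial in several variables to the line `t ↦ p + t w`. -/
noncomputable def restrictToLine {d : ℕ} (p w : Fin d → ℂ) :
    MvPolynomial (Fin d) ℂ →ₐ[ℂ] Polynomial ℂ :=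
  MvPolynomial.aeval fun j => Polynomial.C (p j) + Polynomial.C (w j) * Polynomial.X

section restrictToLine

variable {d : ℕ} (p w : Fin d → ℂ) (f : MvPolynomial (Fin d) ℂ)

theorem natDegree_restrictToLine_le : (restrictToLine p w f).natDegree ≤ f.totalDegree := by
  have := MvPolynomial.aeval_natDegree_le (n := 1) f le_rfl
    (fun j => Polynomial.C (p j) + Polynomial.C (w j) * Polynomial.X)
    fun j => by compute_degree
  rwa [mul_one] at this

theorem eval_restrictToLine (t : ℂ) :
    (restrictToLine p w f).eval t = MvPolynomial.eval (p + t • w) f := by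
  have : (Polynomial.aeval t).comp (restrictToLine p w) = MvPolynomial.aeval (p + t • w) := by
    refine MvPolynomial.algHom_ext fun j => ?_
    simp only [restrictToLine, AlgHom.comp_apply, MvPolynomial.aeval_X, map_add, map_mul,
      Polynomial.aeval_C, Polynomial.aeval_X, Pi.add_apply, Pi.smul_apply, smul_eq_mul,
      Algebra.algebraMap_self, RingHom.id_apply, mul_comm]
  simpa [MvPolynomial.aeval_eq_eval] using DFunLike.congr_fun this f

/-- The chain rule; at parameter `0` the right side is the gradient at `p` paired with `w`. -/
theorem derivative_restrictToLine :
    Polynomial.derivative (restrictToLine p w f) =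
      ∑ j, restrictToLine p w (MvPolynomial.pderiv j f) * Polynomial.C (w j) := by
  induction f using MvPolynomial.induction_on with
  | C a => simp [restrictToLine]
  | add f g hf hg => simp [hf, hg, add_mul, Finset.sum_add_distrib]
  | mul_X f i hf =>
    rw [map_mul, Polynomial.derivative_mul, hf]
    have h1 : Polynomial.derivative (restrictToLine p w (MvPolynomial.X i)) =
        Polynomial.C (w i) := by
      simp [restrictToLine]
    have h2 : ∀ j, restrictToLine p w (MvPolynomial.pderiv j (f * MvPolynomial.X i)) *
        Polynomial.C (w j) = restrictToLine p w (MvPolynomial.pderiv j f) * Polynomial.C (w j) *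
          restrictToLine p w (MvPolynomial.X i) +
        if i = j then restrictToLine p w f * Polynomial.C (w j) else 0 := by
      intro j
      rw [MvPolynomial.pderiv_mul, map_add, map_mul, map_mul, MvPolynomial.pderiv_X,
        Pi.single_apply]
      split_ifs with h
      · rw [map_one]; ring
      · rw [map_zero]; ring
    rw [h1, Finset.sum_congr rfl fun j _ => h2 j, Finset.sum_add_distrib, ← Finset.sum_mul,
      Finset.sum_ite_eq, if_pos (Finset.mem_univ i)]

/-- If a polynomial vanishes at more points of a line than its degree, then the direction of the
line is annihilated by its gradient. -/
theorem sum_pderiv_mul_eq_zero_of_vanish (T : Finset ℂ) (hT : f.totalDegree < T.card)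
    (hz : ∀ t ∈ T, MvPolynomial.eval (p + t • w) f = 0) :
    ∑ j, MvPolynomial.eval p (MvPolynomial.pderiv j f) * w j = 0 := by
  have h0 : restrictToLine p w f = 0 :=
    Polynomial.eq_zero_of_natDegree_lt_card_of_eval_eq_zero' _ T
      (fun t ht => by rw [eval_restrictToLine, hz t ht])
      ((natDegree_restrictToLine_le p w f).trans_lt hT)
  have h1 := congrArg (Polynomial.eval 0) (derivative_restrictToLine p w f)
  rw [h0] at h1
  simpa [Polynomial.eval_finsetSum, eval_restrictToLine] using h1.symm

end restrictToLine

/-- Any `m + 2` distinct points on a line satisfy a linear relation with nonzero coefficients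
that holds for the values of all polynomials of degree at most `m`. -/
theorem exists_relation_of_line {d : ℕ} (p w : Fin d → ℂ) (T : Finset ℂ) :
    ∃ c : ℂ → ℂ, (∀ t ∈ T, c t ≠ 0) ∧ ∀ f : MvPolynomial (Fin d) ℂ, f.totalDegree + 2 ≤ T.card →
      ∑ t ∈ T, c t * MvPolynomial.eval (p + t • w) f = 0 := by
  -- Divided-difference weights: by Lagrange interpolation the sum is the coefficient of degree
  -- `T.card - 1`, which is zero for smaller degree.
  refine ⟨fun t => (∏ j ∈ T.erase t, (t - j))⁻¹, fun t _ => ?_, fun f hf => ?_⟩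
  · refine inv_ne_zero (Finset.prod_ne_zero_iff.2 fun j hj => ?_)
    exact sub_ne_zero.2 (Finset.ne_of_mem_erase hj).symm
  · have hd := natDegree_restrictToLine_le p w f
    have h := Lagrange.coeff_eq_sum (s := T) (v := id) Function.injective_id.injOn
      (P := restrictToLine p w f)
      (Polynomial.degree_le_natDegree.trans_lt (by exact_mod_cast (by omega)))
    rw [Polynomial.coeff_eq_zero_of_natDegree_lt (by omega)] at h
    rw [h]
    refine Finset.sum_congr rfl fun t _ => ?_
    rw [← eval_restrictToLine, div_eq_inv_mul]
    rfl

/-- A line through `v` has a direction vector `w`; we record the parameter of each point. -/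
theorem IsFlat.exists_param {d : ℕ} {L : AffineSubspace ℂ (Fin d → ℂ)} (h : IsFlat 1 L)
    {v : Fin d → ℂ} (hv : v ∈ L) :
    ∃ (w : Fin d → ℂ) (τ : (Fin d → ℂ) → ℂ), ∀ x ∈ L, v + τ x • w = x := by
  classical
  obtain ⟨w, -, hw⟩ := finrank_eq_one_iff'.1 h.2
  have hx : ∀ x ∈ L, ∃ t : ℂ, v + t • (w : Fin d → ℂ) = x := fun x hx => by
    obtain ⟨t, ht⟩ := hw ⟨x -ᵥ v, AffineSubspace.vsub_mem_direction hx hv⟩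
    refine ⟨t, ?_⟩
    have : t • (w : Fin d → ℂ) = x - v := congrArg Subtype.val ht
    rw [this]
    abel
  exact ⟨w, fun x => if hxL : x ∈ L then (hx x hxL).choose else 0, fun x hxL => by
    simpa [hxL] using (hx x hxL).choose_spec⟩

theorem injOn_of_param {d : ℕ} {v w : Fin d → ℂ} {τ : (Fin d → ℂ) → ℂ} {S : Set (Fin d → ℂ)}
    (h : ∀ x ∈ S, v + τ x • w = x) : Set.InjOn τ S := fun x hx y hy hxy => by
  rw [← h x hx, ← h y hy, hxy]

theorem IsFlat.eq_of_mem {d : ℕ} {L L' : AffineSubspace ℂ (Fin d → ℂ)} (h : IsFlat 1 L)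
    (h' : IsFlat 1 L') {p q : Fin d → ℂ} (hpq : p ≠ q) (hp : p ∈ L) (hq : q ∈ L) (hp' : p ∈ L')
    (hq' : q ∈ L') : L = L' := by
  have key : ∀ L : AffineSubspace ℂ (Fin d → ℂ), IsFlat 1 L → p ∈ L → q ∈ L →
      L = line[ℂ, p, q] := by
    intro L hL hpL hqL
    have hle : line[ℂ, p, q] ≤ L := affineSpan_pair_le_of_mem_of_mem hpL hqL
    have hd : Module.finrank ℂ (line[ℂ, p, q] : AffineSubspace ℂ (Fin d → ℂ)).direction = 1 := by
      rw [direction_affineSpan, vectorSpan_pair_rev]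
      exact finrank_span_singleton (by simpa [sub_eq_zero] using hpq.symm)
    refine (AffineSubspace.eq_of_direction_eq_of_nonempty_of_le ?_
      ⟨p, left_mem_affineSpan_pair ℂ p q⟩ hle).symm
    exact Submodule.eq_of_le_of_finrank_eq (AffineSubspace.direction_le hle) (hd.trans hL.2.symm)
  rw [key L h hp hq, key L' h' hp' hq']

/-- Collinear points satisfy a linear relation with nonzero coefficients that holds for the values
of all polynomials of low degree. -/
theorem IsFlat.exists_relation {d : ℕ} {L : AffineSubspace ℂ (Fin d → ℂ)} (h : IsFlat 1 L)
    {S : Finset (Fin d → ℂ)} (hS : ∀ x ∈ S, x ∈ L) :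
    ∃ c : (Fin d → ℂ) → ℂ, (∀ x ∈ S, c x ≠ 0) ∧ ∀ f : MvPolynomial (Fin d) ℂ,
      f.totalDegree + 2 ≤ S.card → ∑ x ∈ S, c x * MvPolynomial.eval x f = 0 := by
  classical
  obtain ⟨v, hv⟩ := h.1
  obtain ⟨w, τ, hτ⟩ := h.exists_param hv
  have hinj : Set.InjOn τ (S : Set (Fin d → ℂ)) := injOn_of_param fun x hx => hτ x (hS x hx)
  obtain ⟨c, hc, hrel⟩ := exists_relation_of_line v w (S.image τ)
  refine ⟨fun x => c (τ x), fun x hx => hc _ (Finset.mem_image_of_mem _ hx), fun f hf => ?_⟩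
  have := hrel f (by rwa [Finset.card_image_of_injOn hinj])
  rw [Finset.sum_image hinj] at this
  rw [← this]
  exact Finset.sum_congr rfl fun x hx => by rw [hτ x (hS x hx)]

/-! ### A vanishing polynomial by dimension count -/

/-- The polynomial with prescribed coefficients at the monomials of degree at most `m` in each
variable. -/
noncomputable def boxPolynomial (d m : ℕ) :
    ((Fin d → Fin (m + 1)) → ℂ) →ₗ[ℂ] MvPolynomial (Fin d) ℂ :=
  ∑ a : Fin d → Fin (m + 1), MvPolynomial.monomial
    (Finsupp.equivFunOnFinite.symm fun i => (a i : ℕ)) ∘ₗ LinearMap.proj a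

theorem boxPolynomial_injective (d m : ℕ) : Function.Injective (boxPolynomial d m) := by
  classical
  rw [injective_iff_map_eq_zero]
  intro x hx
  ext b
  have h := congrArg (MvPolynomial.coeff (Finsupp.equivFunOnFinite.symm fun i => (b i : ℕ))) hx
  simp only [boxPolynomial, LinearMap.sum_apply, LinearMap.comp_apply, LinearMap.proj_apply,
    MvPolynomial.coeff_sum, MvPolynomial.coeff_monomial, MvPolynomial.coeff_zero] at h
  rw [Finset.sum_eq_single b, if_pos rfl] at h
  · exact h
  · intro a _ hab
    refine if_neg fun h' => hab ?_
    ext i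
    exact congrFun (Finsupp.equivFunOnFinite.symm.injective h') i
  · exact fun h => absurd (Finset.mem_univ b) h

/-- The box makes the dimension exactly `(m + 1) ^ d`, at the price of degree `d * m`; this is a
source of the `d ^ d` in the final constant. -/
theorem totalDegree_boxPolynomial_le (d m : ℕ) (x : (Fin d → Fin (m + 1)) → ℂ) :
    (boxPolynomial d m x).totalDegree ≤ d * m := by
  simp only [boxPolynomial, LinearMap.sum_apply, LinearMap.comp_apply, LinearMap.proj_apply]
  refine MvPolynomial.totalDegree_finsetSum_le fun a _ => ?_
  refine (MvPolynomial.totalDegree_monomial_le _ _).trans ?_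
  rw [Finsupp.sum_fintype _ _ (by simp)]
  calc _ ≤ ∑ i : Fin d, m := Finset.sum_le_sum fun i _ => Nat.lt_succ_iff.1 (a i).2
    _ = d * m := by simp

/-- A configuration of points and large collinear subsets, in which every point has high degree,
lies in the zero set of a polynomial of low degree. -/
theorem exists_vanishing_polynomial {d m r : ℕ} {k : ℝ} (V : Finset (Fin d → ℂ))
    (ℒ : Finset (AffineSubspace ℂ (Fin d → ℂ)))
    (S : AffineSubspace ℂ (Fin d → ℂ) → Finset (Fin d → ℂ)) (hflat : ∀ l ∈ ℒ, IsFlat 1 l)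
    (hSV : ∀ l ∈ ℒ, S l ⊆ V) (hSl : ∀ l ∈ ℒ, ∀ x ∈ S l, x ∈ l) (hr : ∀ l ∈ ℒ, (S l).card ≤ r)
    (hm : ∀ l ∈ ℒ, d * m + 2 ≤ (S l).card) (hk0 : 0 ≤ k)
    (hk : ∀ v ∈ V, k ≤ {l ∈ ℒ | v ∈ S l}.card)
    (hcount : ℒ.card * (r : ℝ) ^ 2 < k ^ 2 * ((m : ℝ) + 1) ^ d) :
    ∃ f : MvPolynomial (Fin d) ℂ, f ≠ 0 ∧ f.totalDegree ≤ d * m ∧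
      ∀ v ∈ V, MvPolynomial.eval v f = 0 := by
  classical
  choose c hc hrel using fun l : ℒ => (hflat l l.2).exists_relation (hSl l l.2)
  let A : Matrix ℒ V ℂ := fun l v => if (v : Fin d → ℂ) ∈ S l then c l v else 0
  have hA : ∀ l v, A l v ≠ 0 ↔ (v : Fin d → ℂ) ∈ S l := fun l v => by
    by_cases h : (v : Fin d → ℂ) ∈ S l
    · simp [A, h, hc l v h]
    · simp [A, h]
  have hker := sq_mul_finrank_ker_le A (k := k) (r := r) hk0 (fun l => ?_) (fun v => ?_)
    fun u v huv l l' h1 h2 h3 h4 => ?_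
  · let ev : ((Fin d → Fin (m + 1)) → ℂ) →ₗ[ℂ] (V → ℂ) :=
      (LinearMap.pi fun v : V => (MvPolynomial.aeval (v : Fin d → ℂ)).toLinearMap) ∘ₗ
        boxPolynomial d m
    have hev : ∀ x, ev x ∈ LinearMap.ker A.mulVecLin := fun x => by
      rw [LinearMap.mem_ker]
      ext l
      have h := hrel l (boxPolynomial d m x)
        ((Nat.add_le_add_right (totalDegree_boxPolynomial_le d m x) 2).trans (hm l l.2))
      calc ∑ v : V, A l v * ev x v
          = ∑ v ∈ V, if v ∈ S l then c l v * MvPolynomial.eval v (boxPolynomial d m x) else 0 := by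
            rw [← Finset.sum_coe_sort V]
            refine Finset.sum_congr rfl fun v _ => ?_
            simp [A, ev, ite_mul, MvPolynomial.aeval_eq_eval]
        _ = 0 := by
            rw [← Finset.sum_filter, Finset.filter_mem_eq_inter,
              Finset.inter_eq_right.2 (hSV l l.2), h]
    -- Without such a polynomial, evaluation embeds the coefficient space into the kernel, which is
    -- too small by `hcount`.
    by_contra hcon
    have hinj : Function.Injective (ev.codRestrict _ hev) := by
      rw [injective_iff_map_eq_zero]
      intro x hx
      have hx' : ev x = 0 := congrArg Subtype.val hx
      by_contra hx0
      refine hcon ⟨boxPolynomial d m x,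
        fun h => hx0 (boxPolynomial_injective d m (by simpa using h)),
        totalDegree_boxPolynomial_le d m x, fun v hv => ?_⟩
      simpa [ev, MvPolynomial.aeval_eq_eval] using congrFun hx' ⟨v, hv⟩
    have hdim := LinearMap.finrank_le_finrank_of_injective hinj
    rw [Module.finrank_fintype_fun_eq_card, Fintype.card_fun, Fintype.card_fin,
      Fintype.card_fin] at hdim
    have hdim' : ((m : ℝ) + 1) ^ d ≤ Module.finrank ℂ (LinearMap.ker A.mulVecLin) := by
      exact_mod_cast hdim
    rw [Fintype.card_coe] at hker
    nlinarith [mul_le_mul_of_nonneg_left hdim' (sq_nonneg k)]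
  · refine le_trans ?_ (hr l l.2)
    refine Finset.card_le_card_of_injOn Subtype.val (fun v hv => ?_) Subtype.val_injective.injOn
    simpa [hA] using hv
  · refine (hk v v.2).trans ?_
    rw [← Finset.card_map (Function.Embedding.subtype _)]
    gcongr
    intro l hl
    rw [Finset.mem_filter] at hl
    simp only [Finset.mem_map, Finset.mem_filter, Finset.mem_univ, true_and]
    exact ⟨⟨l, hl.1⟩, (hA _ _).2 hl.2, rfl⟩
  · rw [hA] at h1 h2 h3 h4
    exact Subtype.ext ((hflat l l.2).eq_of_mem (hflat l' l'.2) (fun h => huv (Subtype.ext h))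
      (hSl l l.2 _ h1) (hSl l l.2 _ h2) (hSl l' l'.2 _ h3) (hSl l' l'.2 _ h4))

/-! ### Hyperplanes and incidence counts -/

/-- A hyperplane given by a nonzero linear functional, through a point. -/
theorem exists_hyperplane {d : ℕ} (v g : Fin d → ℂ) (hg : g ≠ 0) :
    ∃ H : AffineSubspace ℂ (Fin d → ℂ), IsFlat (d - 1) H ∧
      ∀ w, ∑ j, g j * w j = 0 → v + w ∈ H := by
  let φ : (Fin d → ℂ) →ₗ[ℂ] ℂ := ∑ j, g j • LinearMap.proj j
  have hφ : ∀ w, φ w = ∑ j, g j * w j := fun w => by simp [φ]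
  have hne : φ ≠ 0 := fun h => hg <| by
    ext j
    have := hφ (Pi.single j 1)
    simpa [h, Pi.single_apply] using this.symm
  refine ⟨AffineSubspace.mk' v (LinearMap.ker φ), ⟨AffineSubspace.mk'_nonempty _ _, ?_⟩,
    fun w hw => ?_⟩
  · rw [AffineSubspace.direction_mk']
    have h1 := LinearMap.finrank_range_add_finrank_ker φ
    rw [LinearMap.range_eq_top.2 (LinearMap.surjective hne), finrank_top] at h1
    simp only [Module.finrank_self, Module.finrank_fin_fun] at h1
    omega
  · rw [AffineSubspace.mem_mk', vsub_eq_sub, add_sub_cancel_left, LinearMap.mem_ker, hφ, hw]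

theorem pointsOn_le_maxOnFlat {d k : ℕ} (hk : k ≤ d) (V : Finset (Fin d → ℂ))
    {H : AffineSubspace ℂ (Fin d → ℂ)} (hH : IsFlat k H) : pointsOn V H ≤ maxOnFlat k V :=
  (maxOnFlat_isGreatest hk V).2 ⟨H, hH, rfl⟩

theorem card_le_pointsOn {d : ℕ} {V W : Finset (Fin d → ℂ)} {H : AffineSubspace ℂ (Fin d → ℂ)}
    (hWV : W ⊆ V) (hWH : ∀ x ∈ W, x ∈ H) : W.card ≤ pointsOn V H := by
  rw [← Set.ncard_coe_finset W]
  exact Set.ncard_le_ncard (fun x hx => ⟨hWV hx, hWH x hx⟩) (V.finite_toSet.inter_of_left _)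

/-- A rich line contains a set of exactly `r` points of `V`. -/
theorem exists_subset_of_mem_richLines {d r : ℕ} {V : Finset (Fin d → ℂ)}
    {l : AffineSubspace ℂ (Fin d → ℂ)} (hl : l ∈ richLines r V) :
    ∃ S ⊆ V, S.card = r ∧ ∀ x ∈ S, x ∈ l := by
  classical
  have h : r ≤ (V.filter fun x => x ∈ l).card := by
    rw [← Set.ncard_coe_finset]
    simpa [pointsOn, Set.inter_def] using hl.2
  obtain ⟨S, hS, hc⟩ := Finset.exists_subset_card_eq h
  exact ⟨S, hS.trans (Finset.filter_subset _ _), hc, fun x hx => (Finset.mem_filter.1 (hS hx)).2⟩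

/-- Two points determine a line, so there are at most `n²` rich lines. -/
theorem ncard_richLines_le_sq {d r : ℕ} (hr : 2 ≤ r) (V : Finset (Fin d → ℂ)) :
    (richLines r V).ncard ≤ V.card ^ 2 := by
  classical
  have hpair : ∀ l ∈ richLines r V, ∃ p : (Fin d → ℂ) × (Fin d → ℂ),
      p ∈ V ×ˢ V ∧ p.1 ≠ p.2 ∧ p.1 ∈ l ∧ p.2 ∈ l := fun l hl => by
    obtain ⟨S, hSV, hc, hSl⟩ := exists_subset_of_mem_richLines hl
    obtain ⟨a, ha, b, hb, hab⟩ := Finset.one_lt_card.1 (show 1 < S.card by omega)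
    exact ⟨(a, b), by simp [hSV ha, hSV hb], hab, hSl a ha, hSl b hb⟩
  choose! p hp using hpair
  rw [sq, ← Finset.card_product, ← Set.ncard_coe_finset]
  refine Set.ncard_le_ncard_of_injOn p (fun l hl => (hp l hl).1) (fun l hl l' hl' h => ?_)
    (Finset.finite_toSet _)
  obtain ⟨-, h1, h2, h3⟩ := hp l hl
  obtain ⟨-, -, h2', h3'⟩ := hp l' hl'
  rw [← h] at h2' h3'
  exact hl.1.eq_of_mem hl'.1 h1 h2 h3 h2' h3'

/-- If a polynomial of low degree vanishes on many points of every line of a family through `v`,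
but has nonzero gradient at `v`, then the lines of the family lie in a hyperplane. -/
theorem exists_hyperplane_of_gradient {d : ℕ} {f : MvPolynomial (Fin d) ℂ} {v : Fin d → ℂ}
    {i : Fin d} (hi : MvPolynomial.eval v (MvPolynomial.pderiv i f) ≠ 0)
    (ℒ : Set (AffineSubspace ℂ (Fin d → ℂ)))
    (T : AffineSubspace ℂ (Fin d → ℂ) → Finset (Fin d → ℂ))
    (hflat : ∀ l ∈ ℒ, IsFlat 1 l) (hv : ∀ l ∈ ℒ, v ∈ l) (hTl : ∀ l ∈ ℒ, ∀ x ∈ T l, x ∈ l)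
    (hT : ∀ l ∈ ℒ, f.totalDegree < (T l).card)
    (hz : ∀ l ∈ ℒ, ∀ x ∈ T l, MvPolynomial.eval x f = 0) :
    ∃ H : AffineSubspace ℂ (Fin d → ℂ), IsFlat (d - 1) H ∧ ∀ l ∈ ℒ, ∀ x ∈ l, x ∈ H := by
  classical
  obtain ⟨H, hH, hmem⟩ := exists_hyperplane v
    (fun j => MvPolynomial.eval v (MvPolynomial.pderiv j f)) fun h => hi (congrFun h i)
  refine ⟨H, hH, fun l hl x hx => ?_⟩
  obtain ⟨w, τ, hτ⟩ := (hflat l hl).exists_param (hv l hl)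
  have hτT : ∀ y ∈ (T l : Set (Fin d → ℂ)), v + τ y • w = y := fun y hy => hτ y (hTl l hl y hy)
  have hw := sum_pderiv_mul_eq_zero_of_vanish v w f ((T l).image τ)
    (by rw [Finset.card_image_of_injOn (injOn_of_param hτT)]; exact hT l hl) (by
      intro t ht
      obtain ⟨y, hy, rfl⟩ := Finset.mem_image.1 ht
      rw [hτT y hy, hz l hl y hy])
  rw [← hτ x hx]
  refine hmem _ ?_
  calc _ = τ x * ∑ j, MvPolynomial.eval v (MvPolynomial.pderiv j f) * w j := by
        rw [Finset.mul_sum]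
        exact Finset.sum_congr rfl fun j _ => by simp; ring
    _ = 0 := by rw [hw, mul_zero]

/-- The points, other than `v`, of sets of size `r` on distinct lines through `v` are distinct. -/
theorem card_mul_sub_one_le_pointsOn {d r : ℕ} {V : Finset (Fin d → ℂ)} {v : Fin d → ℂ}
    {H : AffineSubspace ℂ (Fin d → ℂ)} (ℒ : Finset (AffineSubspace ℂ (Fin d → ℂ)))
    (S : AffineSubspace ℂ (Fin d → ℂ) → Finset (Fin d → ℂ)) (hflat : ∀ l ∈ ℒ, IsFlat 1 l)
    (hS : ∀ l ∈ ℒ, S l ⊆ V ∧ (S l).card = r) (hSl : ∀ l ∈ ℒ, ∀ x ∈ S l, x ∈ l)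
    (hv : ∀ l ∈ ℒ, v ∈ S l) (hH : ∀ l ∈ ℒ, ∀ x ∈ l, x ∈ H) :
    ℒ.card * (r - 1) ≤ pointsOn V H := by
  classical
  have hdisj : (ℒ : Set (AffineSubspace ℂ (Fin d → ℂ))).PairwiseDisjoint
      fun l => (S l).erase v := by
    intro l hl l' hl' hll'
    refine Finset.disjoint_left.2 fun x hx hx' => hll' ?_
    rw [Finset.mem_erase] at hx hx'
    exact (hflat l hl).eq_of_mem (hflat l' hl') hx.1 (hSl l hl x hx.2) (hSl l hl v (hv l hl))
      (hSl l' hl' x hx'.2) (hSl l' hl' v (hv l' hl'))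
  calc ℒ.card * (r - 1) = ∑ l ∈ ℒ, ((S l).erase v).card := by
        rw [Finset.sum_congr rfl fun l hl => by
          rw [Finset.card_erase_of_mem (hv l hl), (hS l hl).2]]
        simp
    _ = (ℒ.biUnion fun l => (S l).erase v).card := (Finset.card_biUnion hdisj).symm
    _ ≤ pointsOn V H := card_le_pointsOn
        (Finset.biUnion_subset.2 fun l hl => (Finset.erase_subset _ _).trans (hS l hl).1)
        fun x hx => by
          obtain ⟨l, hl, hx⟩ := Finset.mem_biUnion.1 hx
          exact hH l hl x (hSl l hl x (Finset.mem_of_mem_erase hx))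

/-! ### The dichotomy and the choice of constants -/

/-- Either there are few rich lines, or many points lie on a hyperplane. -/
theorem ncard_richLines_le_or {d r : ℕ} (hd : 1 ≤ d) (hr : 2 ≤ r) (V : Finset (Fin d → ℂ)) :
    ((richLines r V).ncard : ℝ) ≤ 16 * (6 * d) ^ d * ((V.card : ℝ) ^ 2 / (r : ℝ) ^ d) ∨
      ((richLines r V).ncard : ℝ) * (r : ℝ) ^ 2 ≤ 8 * V.card * maxOnFlat (d - 1) V := by
  classical
  have hr0 : (0 : ℝ) < r := by positivity
  have hd1 : (1 : ℝ) ≤ d := by exact_mod_cast hd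
  rw [or_iff_not_imp_left, not_le]
  intro hmany
  -- For `r = 2` a pruned line may keep a single point and the subtraction in `δ` would truncate;
  -- there the trivial bound `n²` already contradicts `hmany`.
  have hr3 : 3 ≤ r := by
    by_contra h
    obtain rfl : r = 2 := by omega
    have h1 : ((richLines 2 V).ncard : ℝ) ≤ (V.card : ℝ) ^ 2 := by
      exact_mod_cast ncard_richLines_le_sq le_rfl V
    refine absurd (h1.trans ?_) hmany.not_ge
    have h2 : (2 : ℝ) ^ d ≤ (6 * d) ^ d := by gcongr; linarith
    rw [← mul_div_assoc, le_div_iff₀ (by positivity)]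
    push_cast
    nlinarith [mul_le_mul_of_nonneg_left h2 (sq_nonneg (V.card : ℝ)), sq_nonneg (V.card : ℝ),
      show (0 : ℝ) ≤ (V.card : ℝ) ^ 2 * (6 * d) ^ d by positivity]
  let ℒ : Finset (AffineSubspace ℂ (Fin d → ℂ)) := (richLines_finite hr V).toFinset
  have hℒ : ∀ l, l ∈ ℒ ↔ l ∈ richLines r V := fun l => by simp [ℒ]
  have hcard : (richLines r V).ncard = ℒ.card :=
    Set.ncard_eq_toFinset_card _ (richLines_finite hr V)
  rw [hcard] at hmany ⊢
  have hNpos : (0 : ℝ) < ℒ.card := lt_of_le_of_lt (by positivity) hmany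
  have hℒne : ℒ.Nonempty := Finset.card_pos.1 (by exact_mod_cast hNpos)
  choose! S hSV hSc hSl using
    fun l (hl : l ∈ richLines r V) => exists_subset_of_mem_richLines hl
  have hVne : V.Nonempty := by
    obtain ⟨l, hl⟩ := hℒne
    rw [hℒ] at hl
    have : (S l).Nonempty := Finset.card_pos.1 (by rw [hSc l hl]; omega)
    exact this.mono (hSV l hl)
  have hnpos : (0 : ℝ) < V.card := by exact_mod_cast hVne.card_pos
  obtain ⟨V', hV', ℒ', hℒ', hV'ne, hdeg, hhalf⟩ := exists_regular_subsystem V ℒ S (by omega) hVne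
    hℒne fun l hl => ⟨hSV l ((hℒ l).1 hl), hSc l ((hℒ l).1 hl)⟩
  have hrich : ∀ l ∈ ℒ', l ∈ richLines r V := fun l hl => (hℒ l).1 (hℒ' hl)
  -- Every pruned line keeps at least `⌈r / 2⌉ = δ + 2` points, so `δ` is the largest degree
  -- admissible for the relations on all lines.
  set δ := (r + 1) / 2 - 2 with hδ
  have hdm : d * (δ / d) ≤ δ := Nat.mul_div_le δ d
  have hdm' : δ < d * (δ / d + 1) := by
    have := Nat.div_add_mod δ d
    have := Nat.mod_lt δ (show 0 < d by omega)
    rw [mul_add]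
    omega
  have hrm : (r : ℝ) ≤ 6 * d * ((δ / d : ℕ) + 1) := by
    have : r ≤ 6 * (d * (δ / d + 1)) := by omega
    have h' : (r : ℝ) ≤ ((6 * (d * (δ / d + 1)) : ℕ) : ℝ) := by exact_mod_cast this
    push_cast at h' ⊢
    linarith
  -- With `k = N r / (4 n)` and at most `N` lines, the kernel dimension is at most `16 n² / N`;
  -- `hmany` and `r ≤ 6 d (m + 1)` put this below `(m + 1) ^ d`, where `m = δ / d`.
  have hcount : (ℒ'.card : ℝ) * (r : ℝ) ^ 2 <
      (ℒ.card * r / (4 * V.card)) ^ 2 * (((δ / d : ℕ) : ℝ) + 1) ^ d := by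
    have h1 : (ℒ'.card : ℝ) ≤ ℒ.card := by exact_mod_cast Finset.card_le_card hℒ'
    have h2 : (r : ℝ) ^ d ≤ (6 * d) ^ d * (((δ / d : ℕ) : ℝ) + 1) ^ d := by
      rw [← mul_pow]
      gcongr
    rw [← mul_div_assoc, div_lt_iff₀ (by positivity)] at hmany
    have h3 : 16 * (V.card : ℝ) ^ 2 < ℒ.card * (((δ / d : ℕ) : ℝ) + 1) ^ d := by
      refine lt_of_mul_lt_mul_left ?_ (show (0 : ℝ) ≤ (6 * d) ^ d by positivity)
      calc _ = 16 * (6 * d) ^ d * (V.card : ℝ) ^ 2 := by ring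
        _ < ℒ.card * (r : ℝ) ^ d := hmany
        _ ≤ ℒ.card * ((6 * d) ^ d * (((δ / d : ℕ) : ℝ) + 1) ^ d) := by gcongr
        _ = _ := by ring
    calc (ℒ'.card : ℝ) * (r : ℝ) ^ 2 ≤ ℒ.card * (r : ℝ) ^ 2 := by gcongr
      _ = ℒ.card * (r : ℝ) ^ 2 / (16 * (V.card : ℝ) ^ 2) * (16 * (V.card : ℝ) ^ 2) := by
        field_simp
      _ < ℒ.card * (r : ℝ) ^ 2 / (16 * (V.card : ℝ) ^ 2) *
          (ℒ.card * (((δ / d : ℕ) : ℝ) + 1) ^ d) := by gcongr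
      _ = _ := by
        rw [div_pow, mul_pow, mul_pow]
        ring
  obtain ⟨f, hf0, hfdeg, hfV⟩ := exists_vanishing_polynomial (r := r) V' ℒ' (fun l => S l ∩ V')
    (fun l hl => (hrich l hl).1) (fun l _ => Finset.inter_subset_right)
    (fun l hl x hx => hSl l (hrich l hl) x (Finset.mem_of_mem_inter_left hx))
    (fun l hl => (Finset.card_le_card Finset.inter_subset_left).trans (hSc l (hrich l hl)).le)
    (fun l hl => by have := hhalf l hl; omega) (by positivity)
    (fun v hv => by
      have h := hdeg v hv
      have he : {l ∈ ℒ' | v ∈ S l ∩ V'} = {l ∈ ℒ' | v ∈ S l} := by simp [hv]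
      rw [he, div_le_iff₀ (by positivity)]
      have h' : ((ℒ.card * r : ℕ) : ℝ) ≤ ((4 * V.card * {l ∈ ℒ' | v ∈ S l}.card : ℕ) : ℝ) := by
        exact_mod_cast h
      push_cast at h'
      linarith) hcount
  obtain ⟨g, hgdeg, hgV, v, hv, i, hi⟩ :=
    exists_polynomial_pderiv_ne_zero (V := (V' : Set (Fin d → ℂ))) hV'ne hf0 hfdeg hfV
  let ℳ := ℒ'.filter fun l => v ∈ S l
  have hℳ : ∀ l ∈ ℳ, l ∈ ℒ' ∧ v ∈ S l := fun l hl => Finset.mem_filter.1 hl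
  have hℳr : ∀ l ∈ ℳ, l ∈ richLines r V := fun l hl => hrich l (hℳ l hl).1
  obtain ⟨H, hH, hHl⟩ := exists_hyperplane_of_gradient hi (ℳ : Set _) (fun l => S l ∩ V')
    (fun l hl => (hℳr l hl).1) (fun l hl => hSl l (hℳr l hl) v (hℳ l hl).2)
    (fun l hl x hx => hSl l (hℳr l hl) x (Finset.mem_of_mem_inter_left hx))
    (fun l hl => by have := hhalf l (hℳ l hl).1; omega)
    (fun l hl x hx => hgV x (Finset.mem_of_mem_inter_right hx))
  have hpts := (card_mul_sub_one_le_pointsOn ℳ S (fun l hl => (hℳr l hl).1)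
    (fun l hl => ⟨hSV l (hℳr l hl), hSc l (hℳr l hl)⟩) (fun l hl => hSl l (hℳr l hl))
    (fun l hl => (hℳ l hl).2) hHl).trans (pointsOn_le_maxOnFlat (by omega) V hH)
  have h1 : ℒ.card * r ≤ 4 * V.card * ℳ.card := hdeg v hv
  have h2 : ℳ.card * r ≤ 2 * maxOnFlat (d - 1) V := by
    have : r ≤ 2 * (r - 1) := by omega
    nlinarith
  have h3 : ℒ.card * r ^ 2 ≤ 8 * V.card * maxOnFlat (d - 1) V := by
    calc ℒ.card * r ^ 2 = ℒ.card * r * r := by ring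
      _ ≤ 4 * V.card * ℳ.card * r := by gcongr
      _ = 4 * V.card * (ℳ.card * r) := by ring
      _ ≤ 4 * V.card * (2 * maxOnFlat (d - 1) V) := by gcongr
      _ = _ := by ring
  exact_mod_cast h3

theorem ncard_richLines_le_add {d r : ℕ} (hd : 1 ≤ d) (hr : 2 ≤ r) (V : Finset (Fin d → ℂ)) :
    ((richLines r V).ncard : ℝ) ≤ 16 * (6 * d) ^ d * ((V.card : ℝ) ^ 2 / (r : ℝ) ^ d
      + (V.card : ℝ) * (maxOnFlat (d - 1) V : ℝ) / (r : ℝ) ^ 2) := by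
  have hr0 : (0 : ℝ) < r := by positivity
  have hd1 : (1 : ℝ) ≤ d := by exact_mod_cast hd
  have hC : (1 : ℝ) ≤ (6 * d) ^ d := one_le_pow₀ (by linarith)
  rw [mul_add]
  rcases ncard_richLines_le_or hd hr V with h | h
  · exact h.trans (le_add_of_nonneg_right (by positivity))
  · refine le_trans ?_ (le_add_of_nonneg_left (by positivity))
    rw [← le_div_iff₀ (by positivity)] at h
    refine h.trans ?_
    rw [← mul_div_assoc, mul_assoc 8]
    gcongr
    linarith

/-- The points of a finite set on a richest hyperplane. -/
theorem exists_subset_card_eq_maxOnFlat {d k : ℕ} (hk : k ≤ d) (V : Finset (Fin d → ℂ)) :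
    ∃ W ⊆ V, W.card = maxOnFlat k V ∧ ∃ H : AffineSubspace ℂ (Fin d → ℂ), IsFlat k H ∧
      (W : Set (Fin d → ℂ)) ⊆ H := by
  classical
  obtain ⟨H, hH, hc⟩ := (maxOnFlat_isGreatest hk V).1
  refine ⟨V.filter fun x => x ∈ H, Finset.filter_subset _ _, ?_, H, hH, fun x hx => ?_⟩
  · rw [← hc, ← Set.ncard_coe_finset]
    simp [pointsOn, Set.inter_def]
  · exact (Finset.mem_filter.1 hx).2

/-- On the complex line the only candidate for a rich line is the whole space. -/
theorem ncard_richLines_one_le (r : ℕ) (V : Finset (Fin 1 → ℂ)) :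
    (richLines r V).ncard ≤ 1 := by
  have h : ∀ l ∈ richLines r V, l = ⊤ := fun l hl => by
    rw [← AffineSubspace.direction_eq_top_iff_of_nonempty hl.1.1]
    exact Submodule.eq_top_of_finrank_eq (by rw [hl.1.2]; simp)
  exact (Set.ncard_le_ncard h (Set.finite_singleton _)).trans_eq (Set.ncard_singleton _)

/-- A rich line forces `n ≥ r ≥ 2`, while having at most one line forces `n² ≤ r`; these are
incompatible. -/
theorem card_eq_zero_of_sq_div_le_ncard_richLines {r : ℕ} (hr : 2 ≤ r) (V : Finset (Fin 1 → ℂ))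
    (h : (V.card : ℝ) ^ 2 / r ≤ (richLines r V).ncard) : V.card = 0 := by
  by_contra hn
  have hn' : (0 : ℝ) < V.card := by positivity
  have hr2 : (2 : ℝ) ≤ r := by exact_mod_cast hr
  have hpos : (0 : ℝ) < (richLines r V).ncard := lt_of_lt_of_le (by positivity) h
  obtain ⟨l, hl⟩ := Set.nonempty_of_ncard_ne_zero (Nat.cast_pos.1 hpos).ne'
  obtain ⟨S, hSV, hSc, -⟩ := exists_subset_of_mem_richLines hl
  have h1 : (r : ℝ) ≤ V.card := by
    rw [← hSc]
    exact_mod_cast Finset.card_le_card hSV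
  have h2 : ((richLines r V).ncard : ℝ) ≤ 1 := by exact_mod_cast ncard_richLines_one_le r V
  have h3 := h.trans h2
  rw [div_le_one (by positivity)] at h3
  nlinarith

/-- For `d ≥ 2` one has `16 < 5 ^ d` and `30 ≤ d ^ 6`; this is where the exponent `7` comes from. -/
theorem sixteen_mul_pow_lt_rpow {d : ℕ} (hd : 2 ≤ d) :
    16 * (6 * (d : ℝ)) ^ d < (d : ℝ) ^ ((7 : ℝ) * d) := by
  have h2 : (2 : ℝ) ≤ d := by exact_mod_cast hd
  have h4 : (2 : ℝ) ^ 3 ≤ (d : ℝ) ^ 3 := by gcongr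
  rw [show ((7 : ℝ) * d) = ((7 * d : ℕ) : ℝ) by push_cast; ring, Real.rpow_natCast, pow_mul]
  have h5 : (6 * (d : ℝ)) * 5 ≤ (d : ℝ) ^ 7 := by
    have h6 : (2 : ℝ) ^ 6 ≤ (d : ℝ) ^ 6 := by gcongr
    have : (d : ℝ) ^ 7 = d ^ 6 * d := by ring
    rw [this]
    nlinarith
  calc 16 * (6 * (d : ℝ)) ^ d < 5 ^ d * (6 * (d : ℝ)) ^ d := by
        gcongr
        calc (16 : ℝ) < 5 ^ 2 := by norm_num
          _ ≤ 5 ^ d := by gcongr; norm_num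
    _ = (6 * (d : ℝ) * 5) ^ d := by rw [mul_pow, mul_pow, mul_pow]; ring
    _ ≤ _ := by gcongr

theorem eight_mul_rpow_le_rpow {d : ℕ} (hd : 2 ≤ d) :
    8 * (d : ℝ) ^ ((1 : ℝ) * d) ≤ (d : ℝ) ^ ((7 : ℝ) * d) := by
  have h2 : (2 : ℝ) ≤ d := by exact_mod_cast hd
  rw [show ((7 : ℝ) * d) = 1 * d + (6 * d : ℕ) by push_cast; ring,
    Real.rpow_add (by positivity), Real.rpow_natCast, mul_comm]
  gcongr
  calc (8 : ℝ) = 2 ^ 3 := by norm_num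
    _ ≤ 2 ^ (6 * d) := by gcongr <;> [norm_num; omega]
    _ ≤ _ := by gcongr

theorem theorem1 :
    (∃ c c' : ℝ, 0 < c ∧ 0 < c' ∧
      ∀ d : ℕ, 1 ≤ d → ∀ (V : Finset (Fin d → ℂ)) (r : ℕ), 2 ≤ r → ∀ α : ℝ, 1 ≤ α →
        (d : ℝ) ^ (c * (d : ℝ)) * α * ((V.card : ℝ) ^ 2 / (r : ℝ) ^ d)
            ≤ ((richLines r V).ncard : ℝ) →
        ∃ W : Finset (Fin d → ℂ), W ⊆ V ∧
          (d : ℝ) ^ (c' * (d : ℝ)) * α * ((V.card : ℝ) / (r : ℝ) ^ ((d : ℤ) - 2))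
            ≤ (W.card : ℝ) ∧
          ∃ H : AffineSubspace ℂ (Fin d → ℂ), IsFlat (d - 1) H ∧
            (W : Set (Fin d → ℂ)) ⊆ (H : Set (Fin d → ℂ))) ∧
    (∀ d : ℕ, 1 ≤ d → ∃ C : ℝ, 0 < C ∧
      ∀ (V : Finset (Fin d → ℂ)) (r : ℕ), 2 ≤ r →
        ((richLines r V).ncard : ℝ)
          ≤ C * ((V.card : ℝ) ^ 2 / (r : ℝ) ^ d
              + (V.card : ℝ) * (maxOnFlat (d - 1) V : ℝ) / (r : ℝ) ^ 2)) := by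
  refine ⟨⟨7, 1, by norm_num, by norm_num, fun d hd V r hr α hα hmany => ?_⟩,
    fun d hd => ⟨16 * (6 * d) ^ d, by positivity, fun V r hr => ncard_richLines_le_add hd hr V⟩⟩
  obtain ⟨W, hWV, hWc, H, hH, hWH⟩ := exists_subset_card_eq_maxOnFlat (Nat.sub_le d 1) V
  refine ⟨W, hWV, ?_, H, hH, hWH⟩
  rcases Nat.eq_zero_or_pos V.card with hn | hn
  · simp [hn]
  have hn' : (0 : ℝ) < V.card := by exact_mod_cast hn
  have hr0 : (0 : ℝ) < r := by positivity
  -- For `d = 1` the factor `d ^ (c d)` is `1` for every `c`, so no constant can help and a direct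
  -- argument is needed.
  rcases hd.eq_or_lt with rfl | hd2
  · refine absurd (card_eq_zero_of_sq_div_le_ncard_richLines hr V (le_trans ?_ hmany)) hn.ne'
    simp only [Nat.cast_one, Real.one_rpow, one_mul, pow_one]
    exact le_mul_of_one_le_left (by positivity) hα
  have hd0 : (0 : ℝ) < d := by positivity
  rcases ncard_richLines_le_or hd hr V with h | h
  · refine absurd (hmany.trans h) (not_le.2 ?_)
    have := sixteen_mul_pow_lt_rpow hd2
    exact mul_lt_mul_of_pos_right
      (this.trans_le (le_mul_of_one_le_right (by positivity) hα)) (by positivity)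
  · rw [hWc]
    have h1 := (mul_le_mul_of_nonneg_right hmany (sq_nonneg (r : ℝ))).trans h
    rw [zpow_sub₀ hr0.ne', zpow_natCast, zpow_ofNat]
    -- The surplus of `d ^ (7 d)` over `d ^ d` absorbs the factor `8` of the dichotomy.
    refine le_of_mul_le_mul_left ?_ (show (0 : ℝ) < 8 * V.card by positivity)
    refine le_trans ?_ h1
    calc 8 * (V.card : ℝ) * ((d : ℝ) ^ ((1 : ℝ) * d) * α * (V.card / ((r : ℝ) ^ d / (r : ℝ) ^ 2)))
        = 8 * (d : ℝ) ^ ((1 : ℝ) * d) * (α * ((V.card : ℝ) ^ 2 / (r : ℝ) ^ d) * (r : ℝ) ^ 2) := by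
          field_simp
      _ ≤ (d : ℝ) ^ ((7 : ℝ) * d) * (α * ((V.card : ℝ) ^ 2 / (r : ℝ) ^ d) * (r : ℝ) ^ 2) := by
          gcongr ?_ * _
          exact eight_mul_rpow_le_rpow hd2
      _ = _ := by ring
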